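/- Let $\mathbb R^+=[0,\infty)$ and $L^r=L^r(\mathbb R^+)$ (real-valued functions, Lebesgue measure). Let $1\le p\le q<\infty$ and $\lambda>0$, let $v\ge 0$ be locally integrable on $\mathbb R^+$, and suppose that $$\mathcal L f(x)=\int_0^\infty e^{-xy^\lambda}f(y)v(y)\,dy,\qquad x\in\mathbb R^+,$$ (absolutely convergent for every $f\in L^p$ and a.e. $x$) defines a compact operator $\mathcal L\colon L^p\to L^q$. Let $a_n(\mathcal L)=\inf\{\|\mathcal L-K\|_{L^p\to L^q}: K\colon L^p\to L^q \text{ bounded and linear},\ \operatorname{rank}K<n\}$ be its approximation numbers, and for $k\in\mathbb Z$ put $\Delta_k=[2^{k-1},2^k]$ and $\rho_k=\Bigl(\int_0^\infty\bigl[e^{-x2^{k\lambda}}-e^{-x2^{(k+1)\lambda}}\bigr]dx\Bigr)^{1/q}$. (i) Let $p>1$, $p'=p/(p-1)$, $\theta=p'q/(p'+q)$ and $\sigma_k=\rho_k\bigl(\int_{\Delta_k}v^{p'}(y)\,dy\bigr)^{1/p'}$. There is a constant $C<\infty$ depending only on $p,q,\lambda$ such that, if $\sum_{k\in\mathbb Z}\sigma_k^\theta<\infty$,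 then $$\limsup_{n\to\infty}n^{1/q}a_n(\mathcal L)\le C\Bigl(\int_0^\infty t^{-(\lambda+1)\theta/q}\,v^\theta(t)\,dt\Bigr)^{1/\theta}.$$ (ii) Let $p=1$, $\bar\sigma_k=\rho_k\operatorname*{ess\,sup}_{x\in\Delta_k}v(x)$ and $v_\epsilon(t)=\lim_{\epsilon\to0+}\|v\|_{L^\infty(t-\epsilon,t+\epsilon)}$ for $t>0$. There is a constant $C<\infty$ depending only on $q,\lambda$ such that, if $\sum_{k\in\mathbb Z}\bar\sigma_k^q<\infty$, then $$\limsup_{n\to\infty}n^{1/q}a_n(\mathcal L)\le C\Bigl(\int_0^\infty t^{-\lambda-1}\,v_\epsilon^q(t)\,dt\Bigr)^{1/q}.$$ -/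

import Mathlib

open MeasureTheory Set Filter Topology
open scoped ENNReal NNReal

noncomputable section

namespace LaplaceApprox

/-- The `n`-th approximation number `inf {‖T - K‖ : rank K < n}` of a bounded operator,
as an extended nonnegative number (it is finite as soon as `n ≥ 1`). -/
def approxNumber {E F : Type*} [NormedAddCommGroup E] [NormedSpace ℝ E]
    [NormedAddCommGroup F] [NormedSpace ℝ F] (n : ℕ) (T : E →L[ℝ] F) : ℝ≥0∞ :=
  ⨅ (K : E →L[ℝ] F) (_ : (K : E →ₗ[ℝ] F).rank < (n : Cardinal)), ‖T - K‖ₑ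

/-- Lebesgue measure on the half-line. -/
abbrev halfLine : Measure ℝ := volume.restrict (Ioi 0)

/-- `T` is the Laplace type transformation `f ↦ ∫₀^∞ exp (-x y ^ lam) f(y) v(y) dy`
acting from `L^p(0,∞)` to `L^q(0,∞)`: for every `f ∈ L^p` the integral converges absolutely
for a.e. `x > 0`, and it defines the element `T f` of `L^q`. -/
def IsLaplaceTransform (lam : ℝ) (v : ℝ → ℝ) {p q : ℝ≥0∞} [Fact (1 ≤ p)] [Fact (1 ≤ q)]
    (T : Lp ℝ p halfLine →L[ℝ] Lp ℝ q halfLine) : Prop :=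
  ∀ f : Lp ℝ p halfLine,
    (∀ᵐ x ∂halfLine, Integrable (fun y => Real.exp (-(x * y ^ lam)) * f y * v y) halfLine) ∧
    T f =ᵐ[halfLine] fun x => ∫ y, Real.exp (-(x * y ^ lam)) * f y * v y ∂halfLine

/-- The dyadic interval `[2^(k-1), 2^k]`. -/
def dyadic (k : ℤ) : Set ℝ := Icc ((2 : ℝ) ^ (k - 1)) ((2 : ℝ) ^ k)

/-- `(∫₀^∞ [exp (-x 2^(k lam)) - exp (-x 2^((k+1) lam))] dx)^(1/q)`. -/
def kernelFactor (lam q : ℝ) (k : ℤ) : ℝ≥0∞ :=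
  (∫⁻ x in Ioi (0 : ℝ), ENNReal.ofReal
    (Real.exp (-(x * (2 : ℝ) ^ ((k : ℝ) * lam))) -
      Real.exp (-(x * (2 : ℝ) ^ (((k : ℝ) + 1) * lam))))) ^ (1 / q)

/-- The quantity `σ_k`, where `p'` is the conjugate exponent of `p`. -/
def sigma (lam p' q : ℝ) (v : ℝ → ℝ) (k : ℤ) : ℝ≥0∞ :=
  kernelFactor lam q k * (∫⁻ y in dyadic k, ENNReal.ofReal (v y) ^ p') ^ (1 / p')

/-- The quantity `σ̄_k`. -/
def sigmaBar (lam q : ℝ) (v : ℝ → ℝ) (k : ℤ) : ℝ≥0∞ :=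
  essSup (fun y => ENNReal.ofReal (v y)) (volume.restrict (dyadic k)) * kernelFactor lam q k

/-- The local essential supremum `lim_{ε → 0+} ‖v‖_{L^∞(t-ε,t+ε)}`. The norms decrease with `ε`,
so the limit is the infimum; see `tendsto_localEssSup`. -/
def localEssSup (v : ℝ → ℝ) (t : ℝ) : ℝ≥0∞ :=
  ⨅ ε ∈ Ioi (0 : ℝ), eLpNorm v ∞ (volume.restrict (Ioo (t - ε) (t + ε)))

theorem tendsto_localEssSup (v : ℝ → ℝ) (t : ℝ) :
    Tendsto (fun ε : ℝ => eLpNorm v ∞ (volume.restrict (Ioo (t - ε) (t + ε))))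
      (𝓝[>] 0) (𝓝 (localEssSup v t)) := by
  have hm : Monotone fun ε : ℝ => eLpNorm v ∞ (volume.restrict (Ioo (t - ε) (t + ε))) := by
    intro a b hab
    exact eLpNorm_mono_measure _
      (Measure.restrict_mono (Ioo_subset_Ioo (by linarith) (by linarith)) le_rfl)
  have h := hm.tendsto_nhdsGT (0 : ℝ)
  rwa [sInf_image] at h

end LaplaceApprox

end

/-! In fact both limsups vanish: $a_n(\mathcal L)=o(n^{-1/q})$, so any constant works. On a dyadic
block put $s=x2^{k\lambda}$ and $w=(y/2^k)^\lambda\in[2^{-\lambda},1]$. The kernel $e^{-sw}$ is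
analytic in $w$, and its Taylor polynomial at $w=1$ with $m_k$ terms has error at most
$r^{m_k}e^{-(1-r)s}$, where $r=\sqrt{1-2^{-\lambda}}$ (`abs_exp_sub_taylor_le`). The polynomials
give an operator of rank at most $\sum_k m_k$. Since the discretized Laplace transform maps $\ell^q$
to $L^q$ (`exists_lintegral_tsum_exp_le`) and $p\le q$, its error is of order $\sup_k
r^{m_k}\tau_k$, where $\tau_k$ is `kernelFactor` times the $L^{p'}$ norm of $v$ on the block
(`exists_approxNumber_le_of_degrees`). Because the gain in $m_k$ is geometric, a $q$-summable $\tau$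
is brought below $\eta n^{-1/q}$, up to a constant, with total degree less than $n$, for each
$\eta>0$ and large $n$ (`exists_eventually_degrees`). Both summability assumptions give
$\tau\in\ell^q$, as $\theta\le q$. -/

namespace LaplaceApprox

/-! ### Taylor remainders of the exponential. -/

/-- Compare the two tails term by term: a power of `r * u` of order at least `m` contributes a
factor at most `r ^ m`. -/
theorem exp_sub_sum_range_le {t u r : ℝ} (m : ℕ) (hr0 : 0 ≤ r) (hr1 : r ≤ 1) (ht : 0 ≤ t)
    (hu : 0 ≤ u) (htu : t ≤ r * u) :
    Real.exp t - ∑ j ∈ Finset.range m, t ^ j / j.factorial ≤ r ^ m * Real.exp u := by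
  have h1 : ∀ x : ℝ, HasSum (fun j : ℕ => x ^ j / j.factorial) (Real.exp x) := fun x => by
    rw [Real.exp_eq_exp_ℝ]
    exact NormedSpace.expSeries_div_hasSum_exp x
  have h2 := (hasSum_nat_add_iff' m).2 (h1 t)
  have h3 := ((hasSum_nat_add_iff' m).2 (h1 u)).mul_left (r ^ m)
  have h4 : Real.exp t - ∑ j ∈ Finset.range m, t ^ j / j.factorial ≤
      r ^ m * (Real.exp u - ∑ j ∈ Finset.range m, u ^ j / j.factorial) := by
    refine hasSum_le (fun j => ?_) h2 h3
    rw [← mul_div_assoc]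
    gcongr
    calc t ^ (j + m) ≤ (r * u) ^ (j + m) := by gcongr
      _ = r ^ (j + m) * u ^ (j + m) := mul_pow _ _ _
      _ ≤ r ^ m * u ^ (j + m) := by
        gcongr ?_ * _
        exact pow_le_pow_of_le_one hr0 hr1 (Nat.le_add_left m j)
  refine h4.trans ?_
  gcongr
  have : 0 ≤ ∑ j ∈ Finset.range m, u ^ j / j.factorial :=
    Finset.sum_nonneg fun j _ => by positivity
  linarith

/-- Approximation of `exp (-s w)` by the Taylor polynomial at `w = 1`. -/
theorem abs_exp_sub_taylor_le {s w r : ℝ} (m : ℕ) (hr0 : 0 ≤ r) (hr1 : r ≤ 1) (hs : 0 ≤ s)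
    (hw : w ≤ 1) (hwr : 1 - w ≤ r ^ 2) :
    |Real.exp (-(s * w)) -
        ∑ j ∈ Finset.range m, s ^ j / j.factorial * Real.exp (-s) * (1 - w) ^ j| ≤
      r ^ m * Real.exp (-((1 - r) * s)) := by
  have ht : 0 ≤ s * (1 - w) := mul_nonneg hs (by linarith)
  have hE : Real.exp (-(s * w)) -
        ∑ j ∈ Finset.range m, s ^ j / j.factorial * Real.exp (-s) * (1 - w) ^ j =
      Real.exp (-s) * (Real.exp (s * (1 - w)) -
        ∑ j ∈ Finset.range m, (s * (1 - w)) ^ j / j.factorial) := by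
    rw [mul_sub, ← Real.exp_add, Finset.mul_sum]
    congr 1
    · congr 1; ring
    · refine Finset.sum_congr rfl fun j _ => ?_
      rw [mul_pow]; ring
  -- The bound `r ^ 2` is spent twice: one `r` gives the geometric gain, the other leaves `exp (r *
  -- s)`, so that some decay of `exp (-s)` survives.
  have h1 := exp_sub_sum_range_le m hr0 hr1 ht (mul_nonneg hr0 hs)
    (show s * (1 - w) ≤ r * (r * s) by nlinarith)
  have h0 := Real.sum_le_exp_of_nonneg ht m
  rw [hE, abs_of_nonneg (mul_nonneg (Real.exp_pos _).le (by linarith))]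
  calc _ ≤ Real.exp (-s) * (r ^ m * Real.exp (r * s)) := by gcongr
    _ = r ^ m * (Real.exp (-s) * Real.exp (r * s)) := by ring
    _ = _ := by rw [← Real.exp_add]; congr 2; ring

/-! ### Geometric scales and the discretized Laplace transform. -/

/-- The scale `2 ^ (k lam)`. -/
noncomputable def scale (lam : ℝ) (k : ℤ) : ℝ := (2 : ℝ) ^ ((k : ℝ) * lam)

theorem scale_pos (lam : ℝ) (k : ℤ) : 0 < scale lam k := Real.rpow_pos_of_pos two_pos _

theorem scale_eq_zpow (lam : ℝ) (k : ℤ) : scale lam k = ((2 : ℝ) ^ lam) ^ k := by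
  rw [scale, mul_comm, Real.rpow_mul two_pos.le, Real.rpow_intCast]

/-- This is `log z ≤ z` at `z = c * s / a`; the sharp factor `exp (-a)` is dropped. -/
theorem rpow_mul_exp_neg_le {a c s : ℝ} (ha : 0 < a) (hc : 0 < c) (hs : 0 < s) :
    s ^ a * Real.exp (-(c * s)) ≤ (a / c) ^ a := by
  have hx : 0 < c * s / a := by positivity
  have h1 : Real.log (c * s / a) ≤ c * s / a := (Real.log_le_sub_one_of_pos hx).trans (by linarith)
  have h2 : Real.log s = Real.log (c * s / a) + Real.log (a / c) := by
    rw [← Real.log_mul hx.ne' (by positivity)]; congr 1; field_simp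
  rw [Real.rpow_def_of_pos hs, Real.rpow_def_of_pos (by positivity : 0 < a / c), ← Real.exp_add]
  refine Real.exp_le_exp.2 ?_
  rw [h2]
  have h3 : Real.log (c * s / a) * a ≤ c * s := by
    calc _ ≤ c * s / a * a := by gcongr
      _ = c * s := by field_simp
  linarith

theorem summable_zpow_abs {b : ℝ} (hb0 : 0 ≤ b) (hb1 : b < 1) :
    Summable fun k : ℤ => b ^ k.natAbs := by
  refine Summable.of_nat_of_neg ?_ ?_ <;>
  simpa using summable_geometric_of_lt_one hb0 hb1

/-- A uniform bound for sums of `φ s = s ^ a * exp (-c s)` along the geometric progression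
`s = x * scale lam k`. -/
theorem exists_tsum_scale_le {a c lam : ℝ} (ha : 0 < a) (hc : 0 < c) (hlam : 0 < lam) :
    ∃ A : ℝ≥0, ∀ x : ℝ, 0 < x →
      ∑' k : ℤ, ENNReal.ofReal ((x * scale lam k) ^ a * Real.exp (-(c * (x * scale lam k)))) ≤ A := by
  set β : ℝ := (2 : ℝ) ^ lam with hβ
  have hβ1 : 1 < β := Real.one_lt_rpow one_lt_two hlam
  have hβ0 : 0 < β := by linarith
  set b : ℝ := β ^ (-a) with hb
  have hb0 : 0 < b := Real.rpow_pos_of_pos hβ0 _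
  have hb1 : b < 1 := Real.rpow_lt_one_of_one_lt_of_neg hβ1 (by linarith)
  set M : ℝ := max (β ^ a) ((2 * a / c) ^ (2 * a)) with hM
  have hM0 : 0 < M := lt_max_of_lt_left (Real.rpow_pos_of_pos hβ0 _)
  have hsum : Summable fun k : ℤ => M * b ^ k.natAbs := (summable_zpow_abs hb0.le hb1).mul_left M
  refine ⟨(∑' k : ℤ, M * b ^ k.natAbs).toNNReal, fun x hx => ?_⟩
  obtain ⟨k₀, hk1, hk2⟩ := exists_mem_Ico_zpow hx hβ1
  have key : ∀ k : ℤ, (x * scale lam k) ^ a * Real.exp (-(c * (x * scale lam k))) ≤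
      M * b ^ (k + k₀).natAbs := by
    intro k
    have hs : 0 < x * scale lam k := mul_pos hx (scale_pos _ _)
    have hlow : β ^ (k + k₀) ≤ x * scale lam k := by
      rw [zpow_add₀ hβ0.ne', scale_eq_zpow, mul_comm]
      gcongr
    have hupp : x * scale lam k ≤ β ^ (k + k₀ + 1) := by
      rw [add_assoc, zpow_add₀ hβ0.ne', scale_eq_zpow, mul_comm]
      gcongr
    have hbz : ∀ i : ℤ, (β ^ i) ^ a = b ^ (-i) := by
      intro i
      rw [hb, ← Real.rpow_intCast, ← Real.rpow_intCast, ← Real.rpow_mul hβ0.le,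
        ← Real.rpow_mul hβ0.le]
      congr 1; push_cast; ring
    rcases le_total 0 (k + k₀) with h | h
    -- For large `s`, write `s ^ a = s ^ (2 * a) * s ^ (-a)`: the exponential absorbs the first
    -- factor and the second decays geometrically in `k`.
    · have h1 := rpow_mul_exp_neg_le (by linarith : 0 < 2 * a) hc hs
      have h2 : (x * scale lam k) ^ a * Real.exp (-(c * (x * scale lam k))) =
          (x * scale lam k) ^ (2 * a) * Real.exp (-(c * (x * scale lam k))) *
            (x * scale lam k) ^ (-a) := by
        rw [mul_right_comm, ← Real.rpow_add hs]; congr 2; ring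
      rw [h2]
      refine mul_le_mul (h1.trans (le_max_right _ _)) ?_ (by positivity) hM0.le
      obtain ⟨n, hn⟩ := Int.eq_ofNat_of_zero_le h
      rw [hn] at hlow ⊢
      calc (x * scale lam k) ^ (-a) ≤ (β ^ (n : ℤ)) ^ (-a) :=
            Real.rpow_le_rpow_of_nonpos (by positivity) hlow (by linarith)
        _ = b ^ n := by
          rw [Real.rpow_neg (by positivity), hbz]; simp
        _ = b ^ (n : ℤ).natAbs := by simp
        _ ≤ _ := le_rfl
    -- For small `s` the power alone decays; the `+ 1` in the upper bound costs the factor `β ^ a`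
    -- in `M`.
    · have h1 : Real.exp (-(c * (x * scale lam k))) ≤ 1 :=
        Real.exp_le_one_iff.2 (by simp; positivity)
      obtain ⟨n, hn⟩ := Int.eq_ofNat_of_zero_le (neg_nonneg.2 h)
      have hn' : k + k₀ = -(n : ℤ) := by omega
      calc (x * scale lam k) ^ a * Real.exp (-(c * (x * scale lam k)))
          ≤ (x * scale lam k) ^ a * 1 := by gcongr
        _ ≤ (β ^ (k + k₀ + 1)) ^ a := by rw [mul_one]; gcongr
        _ = β ^ a * b ^ n := by
          rw [zpow_add₀ hβ0.ne', Real.mul_rpow (by positivity) (by positivity), hbz, hn']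
          simp [mul_comm]
        _ ≤ M * b ^ (k + k₀).natAbs := by
          rw [hn']
          simp only [Int.natAbs_neg, Int.natAbs_natCast]
          gcongr
          exact le_max_left _ _
  calc _ ≤ ∑' k : ℤ, ENNReal.ofReal (M * b ^ (k + k₀).natAbs) :=
        ENNReal.tsum_le_tsum fun k => ENNReal.ofReal_le_ofReal (key k)
    _ = ∑' k : ℤ, ENNReal.ofReal (M * b ^ k.natAbs) :=
        (Equiv.addRight k₀).tsum_eq (fun k : ℤ => ENNReal.ofReal (M * b ^ k.natAbs))
    _ = ENNReal.ofReal (∑' k : ℤ, M * b ^ k.natAbs) :=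
        (ENNReal.ofReal_tsum_of_nonneg (fun k => by positivity) hsum).symm
    _ ≤ _ := le_rfl

theorem tsum_mul_rpow_le {ι : Type*} {q : ℝ} (hq : 1 ≤ q) (w f : ι → ℝ≥0∞) :
    (∑' i, w i * f i) ^ q ≤ (∑' i, w i) ^ (q - 1) * ∑' i, w i * f i ^ q := by
  have hq0 : 0 < q := by linarith
  have h : ∑' i, w i * f i ≤ (∑' i, w i) ^ (1 - q⁻¹) * (∑' i, w i * f i ^ q) ^ q⁻¹ := by
    rw [ENNReal.tsum_eq_iSup_sum]
    refine iSup_le fun s => (ENNReal.inner_le_weight_mul_Lp_of_nonneg s hq w f).trans ?_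
    have : q⁻¹ ≤ 1 := inv_le_one_of_one_le₀ hq
    refine mul_le_mul' (ENNReal.rpow_le_rpow (ENNReal.sum_le_tsum s) (by linarith))
      (ENNReal.rpow_le_rpow (ENNReal.sum_le_tsum s) (by positivity))
  calc _ ≤ ((∑' i, w i) ^ (1 - q⁻¹) * (∑' i, w i * f i ^ q) ^ q⁻¹) ^ q := by gcongr
    _ = _ := by
      rw [ENNReal.mul_rpow_of_nonneg _ _ hq0.le, ← ENNReal.rpow_mul, ← ENNReal.rpow_mul,
        inv_mul_cancel₀ hq0.ne', ENNReal.rpow_one]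
      congr 2; field_simp

/-- The integral has a nonzero Gamma value, whereas a non-integrable function has integral `0` by
convention. -/
theorem integrable_rpow_mul_exp_neg {a r : ℝ} (ha : 0 < a) (hr : 0 < r) :
    Integrable (fun t : ℝ => t ^ (a - 1) * Real.exp (-(r * t))) halfLine := by
  have hne : (1 / r) ^ a * Real.Gamma a ≠ 0 :=
    (mul_pos (by positivity) (Real.Gamma_pos_of_pos ha)).ne'
  by_contra h
  exact hne (Real.integral_rpow_mul_exp_neg_mul_Ioi ha hr ▸ integral_undef h)

/-- The measure `dx / x` is dilation invariant, so the value does not depend on `s`, that is, on the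
block. -/
theorem lintegral_rpow_mul_exp_scale {a c s : ℝ} (ha : 0 < a) (hc : 0 < c) (hs : 0 < s) :
    ∫⁻ x in Ioi (0 : ℝ), ENNReal.ofReal (x⁻¹ * ((x * s) ^ a * Real.exp (-(c * (x * s))))) =
      ENNReal.ofReal ((1 / c) ^ a * Real.Gamma a) := by
  have hI := Real.integral_rpow_mul_exp_neg_mul_Ioi ha (mul_pos hc hs)
  have hint := integrable_rpow_mul_exp_neg ha (mul_pos hc hs)
  have hEq : ∀ x ∈ Ioi (0 : ℝ), x⁻¹ * ((x * s) ^ a * Real.exp (-(c * (x * s)))) =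
      s ^ a * (x ^ (a - 1) * Real.exp (-(c * s * x))) := by
    intro x hx
    have hx : 0 < x := hx
    rw [Real.mul_rpow hx.le hs.le, Real.rpow_sub_one hx.ne']
    rw [show c * (x * s) = c * s * x by ring]
    field_simp
  rw [setLIntegral_congr_fun measurableSet_Ioi fun x hx => congrArg ENNReal.ofReal (hEq x hx),
    ← ofReal_integral_eq_lintegral_ofReal (hint.const_mul _), integral_const_mul, hI]
  · congr 1
    rw [← mul_assoc, ← Real.mul_rpow hs.le (by positivity)]
    congr 2
    field_simp
  · refine (ae_restrict_iff' measurableSet_Ioi).2 (.of_forall fun x hx => ?_)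
    have hx : 0 < x := hx
    simp only [Pi.zero_apply]
    positivity

/-- Boundedness of the discretized Laplace transform from `ℓ^q` to `L^q`. -/
theorem exists_lintegral_tsum_exp_le {q c lam : ℝ} (hq : 1 ≤ q) (hc : 0 < c) (hlam : 0 < lam) :
    ∃ B : ℝ≥0, ∀ F : ℤ → ℝ≥0∞,
      ∫⁻ x in Ioi (0 : ℝ), (∑' k : ℤ, ENNReal.ofReal
        (scale lam k ^ (1 / q) * Real.exp (-(c * (x * scale lam k)))) * F k) ^ q ≤
      B * ∑' k, F k ^ q := by
  have hq0 : 0 < q := by linarith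
  have hq1 : 0 < 1 / q := by positivity
  obtain ⟨A, hA⟩ := exists_tsum_scale_le hq1 hc hlam
  set G : ℝ := (1 / c) ^ (1 / q) * Real.Gamma (1 / q) with hG
  refine ⟨A ^ (q - 1) * G.toNNReal, fun F => ?_⟩
  set φ : ℤ → ℝ → ℝ := fun k x =>
    (x * scale lam k) ^ (1 / q) * Real.exp (-(c * (x * scale lam k))) with hφ
  have hpt : ∀ x ∈ Ioi (0 : ℝ), (∑' k : ℤ, ENNReal.ofReal
        (scale lam k ^ (1 / q) * Real.exp (-(c * (x * scale lam k)))) * F k) ^ q ≤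
      (A : ℝ≥0∞) ^ (q - 1) * ∑' k, ENNReal.ofReal (x⁻¹ * φ k x) * F k ^ q := by
    intro x hx
    have hx : 0 < x := hx
    -- Extracting `x ^ (-(1 / q))` leaves weights in `x * scale lam k` alone. Their sum is at most
    -- `A`, so weighted Hölder applies, and the extracted factor becomes `dx / x`.
    have h1 : ∀ k, ENNReal.ofReal
        (scale lam k ^ (1 / q) * Real.exp (-(c * (x * scale lam k)))) * F k =
        ENNReal.ofReal (x ^ (-(1 / q))) * (ENNReal.ofReal (φ k x) * F k) := by
      intro k
      rw [← mul_assoc (ENNReal.ofReal _) (ENNReal.ofReal _), ← ENNReal.ofReal_mul (by positivity)]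
      congr 2
      simp only [hφ]
      rw [Real.mul_rpow hx.le (scale_pos _ _).le, Real.rpow_neg hx.le]
      have : x ^ (1 / q) ≠ 0 := (Real.rpow_pos_of_pos hx _).ne'
      field_simp
    simp_rw [h1]
    rw [ENNReal.tsum_mul_left, ENNReal.mul_rpow_of_nonneg _ _ hq0.le,
      ENNReal.ofReal_rpow_of_nonneg (by positivity) hq0.le, ← Real.rpow_mul hx.le,
      show -(1 / q) * q = -1 by field_simp, Real.rpow_neg_one]
    calc _ ≤ ENNReal.ofReal x⁻¹ * ((A : ℝ≥0∞) ^ (q - 1) *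
          ∑' k, ENNReal.ofReal (φ k x) * F k ^ q) := by
          gcongr
          refine (tsum_mul_rpow_le hq _ _).trans ?_
          exact mul_le_mul_left (ENNReal.rpow_le_rpow (hA x hx) (by linarith)) _
      _ = _ := by
        rw [mul_left_comm, ← ENNReal.tsum_mul_left]
        congr 2
        ext k
        rw [← mul_assoc, ← ENNReal.ofReal_mul (by positivity)]
  have hmeas : ∀ k, Measurable fun x : ℝ => ENNReal.ofReal (x⁻¹ * φ k x) := by
    intro k
    simp only [hφ]
    fun_prop
  calc _ ≤ ∫⁻ x in Ioi (0 : ℝ),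
        (A : ℝ≥0∞) ^ (q - 1) * ∑' k, ENNReal.ofReal (x⁻¹ * φ k x) * F k ^ q :=
        setLIntegral_mono' measurableSet_Ioi hpt
    _ = (A : ℝ≥0∞) ^ (q - 1) * ∑' k, ENNReal.ofReal G * F k ^ q := by
      rw [lintegral_const_mul _ (.tsum fun k => (hmeas k).mul_const _),
        lintegral_tsum fun k => ((hmeas k).mul_const _).aemeasurable]
      congr 2
      ext k
      rw [lintegral_mul_const _ (hmeas k)]
      congr 1
      exact lintegral_rpow_mul_exp_scale hq1 hc (scale_pos _ _)
    _ = _ := by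
      rw [ENNReal.tsum_mul_left, ← mul_assoc, ENNReal.coe_mul,
        ENNReal.coe_rpow_of_nonneg _ (by linarith)]
      rfl

/-! ### Dyadic blocks of the half-line. -/

/-- The half-open dyadic block `(2^(k-1), 2^k]`. -/
def block (k : ℤ) : Set ℝ := Ioc ((2 : ℝ) ^ (k - 1)) ((2 : ℝ) ^ k)

theorem measurableSet_block (k : ℤ) : MeasurableSet (block k) := measurableSet_Ioc

theorem pairwise_disjoint_block : Pairwise (Function.onFun Disjoint block) :=
  (zpow_right_mono₀ (one_le_two : (1 : ℝ) ≤ 2)).pairwise_disjoint_on_Ioc_pred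

theorem block_subset_Ioi (k : ℤ) : block k ⊆ Ioi 0 := fun _ hy =>
  lt_trans (zpow_pos two_pos _) hy.1

theorem block_subset_dyadic (k : ℤ) : block k ⊆ dyadic k := Ioc_subset_Icc_self

theorem iUnion_block : ⋃ k, block k = Ioi 0 := by
  refine subset_antisymm (iUnion_subset block_subset_Ioi) fun y hy => ?_
  obtain ⟨n, hn⟩ := exists_mem_Ioc_zpow (show (0 : ℝ) < y from hy) (one_lt_two : (1 : ℝ) < 2)
  refine mem_iUnion.2 ⟨n + 1, ?_⟩
  simpa [block] using hn

theorem lintegral_halfLine_eq_tsum (g : ℝ → ℝ≥0∞) :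
    ∫⁻ y, g y ∂halfLine = ∑' k, ∫⁻ y in block k, g y := by
  rw [halfLine, ← iUnion_block,
    lintegral_iUnion measurableSet_block pairwise_disjoint_block]

theorem halfLine_restrict_block (k : ℤ) : halfLine.restrict (block k) = volume.restrict (block k) :=
  Measure.restrict_restrict_of_subset (block_subset_Ioi k)

theorem one_sub_div_scale_mem {lam y : ℝ} {k : ℤ} (hlam : 0 < lam) (hy : y ∈ block k) :
    0 ≤ 1 - y ^ lam / scale lam k ∧ 1 - y ^ lam / scale lam k ≤ 1 - (2 : ℝ) ^ (-lam) := by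
  have hy0 : 0 < y := block_subset_Ioi k hy
  have h2 : (2 : ℝ) ^ (-lam) * scale lam k = ((2 : ℝ) ^ (k - 1)) ^ lam := by
    rw [scale, ← Real.rpow_add two_pos, ← Real.rpow_intCast, ← Real.rpow_mul two_pos.le]
    congr 1; push_cast; ring
  have h3 : scale lam k = ((2 : ℝ) ^ k) ^ lam := by
    rw [scale, ← Real.rpow_intCast, ← Real.rpow_mul two_pos.le]
  have h4 : y ^ lam ≤ scale lam k := by
    rw [h3]; exact Real.rpow_le_rpow hy0.le hy.2 hlam.le
  have h5 : (2 : ℝ) ^ (-lam) * scale lam k ≤ y ^ lam := by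
    rw [h2]; exact Real.rpow_le_rpow (by positivity) hy.1.le hlam.le
  constructor
  · rw [sub_nonneg]; exact (div_le_one (scale_pos _ _)).2 h4
  · have := (le_div_iff₀ (scale_pos lam k)).2 h5
    linarith

/-! ### Hölder duality, finite-rank operators and block norms. -/

theorem lintegral_enorm_mul_le {p p' : ℝ≥0∞} [ENNReal.HolderConjugate p p'] {μ : Measure ℝ}
    {f v : ℝ → ℝ} (hf : AEStronglyMeasurable f μ) (hv : AEStronglyMeasurable v μ) :
    ∫⁻ y, ‖f y‖ₑ * ‖v y‖ₑ ∂μ ≤ eLpNorm f p μ * eLpNorm v p' μ := by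
  have h := eLpNorm_smul_le_mul_eLpNorm (p := p) (q := p') (r := 1) hv hf
  rw [eLpNorm_one_eq_lintegral_enorm] at h
  simpa [enorm_mul] using h

theorem exists_clm_eq_integral_mul {p p' : ℝ≥0∞} [Fact (1 ≤ p)] [ENNReal.HolderConjugate p p']
    {μ : Measure ℝ} {g : ℝ → ℝ} (hg : MemLp g p' μ) :
    ∃ l : Lp ℝ p μ →L[ℝ] ℝ, ∀ f : Lp ℝ p μ,
      Integrable (fun y => f y * g y) μ ∧ l f = ∫ y, f y * g y ∂μ := by
  have : Fact (1 ≤ p') := ⟨ENNReal.HolderConjugate.one_le p' p⟩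
  refine ⟨((ContinuousLinearMap.mul ℝ ℝ).lpPairing μ p p').flip (hg.toLp g), fun f => ⟨?_, ?_⟩⟩
  · have : ENNReal.HolderTriple p p' 1 := inferInstance
    exact memLp_one_iff_integrable.1 (hg.mul' (Lp.memLp f))
  · rw [ContinuousLinearMap.flip_apply, ContinuousLinearMap.lpPairing_eq_integral]
    refine integral_congr_ae ?_
    filter_upwards [hg.coeFn_toLp] with y hy
    simp [hy]

theorem rank_sum_smulRight_le {E F ι : Type} [NormedAddCommGroup E] [NormedSpace ℝ E]
    [NormedAddCommGroup F] [NormedSpace ℝ F] (s : Finset ι) (l : ι → E →L[ℝ] ℝ) (g : ι → F) :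
    ((∑ i ∈ s, (l i).smulRight (g i) : E →L[ℝ] F) : E →ₗ[ℝ] F).rank ≤ (s.card : Cardinal) := by
  classical
  have h : LinearMap.range ((∑ i ∈ s, (l i).smulRight (g i) : E →L[ℝ] F) : E →ₗ[ℝ] F) ≤
      Submodule.span ℝ (s.image g : Set F) := by
    rintro _ ⟨x, rfl⟩
    simp only [ContinuousLinearMap.coe_coe, sum_apply,
      ContinuousLinearMap.smulRight_apply]
    exact Submodule.sum_mem _ fun i hi => Submodule.smul_mem _ _
      (Submodule.subset_span (Finset.mem_coe.2 (Finset.mem_image_of_mem g hi)))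
  calc _ ≤ Module.rank ℝ (Submodule.span ℝ (s.image g : Set F)) := Submodule.rank_mono h
    _ ≤ ((s.image g).card : Cardinal) := rank_span_finset_le _
    _ ≤ _ := by exact_mod_cast Finset.card_image_le

theorem memLp_pow_mul_exp_neg {q : ℝ≥0∞} (hq0 : q ≠ 0) (hq : q ≠ ∞) (j : ℕ) {s : ℝ} (hs : 0 < s) :
    MemLp (fun x : ℝ => (x * s) ^ j / j.factorial * Real.exp (-(x * s))) q halfLine := by
  have hq' : 0 < q.toReal := ENNReal.toReal_pos hq0 hq
  refine (integrable_norm_rpow_iff (by fun_prop) hq0 hq).1 ?_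
  have h := (integrable_rpow_mul_exp_neg (a := j * q.toReal + 1) (r := q.toReal * s)
    (by positivity) (by positivity)).const_mul ((s ^ j / j.factorial) ^ q.toReal)
  refine h.congr ((ae_restrict_iff' measurableSet_Ioi).2 (.of_forall fun x hx => ?_))
  have hx : 0 < x := hx
  simp only [add_sub_cancel_right]
  rw [Real.norm_of_nonneg (by positivity),
    show (x * s) ^ j / j.factorial * Real.exp (-(x * s)) =
      s ^ j / j.factorial * (x ^ j * Real.exp (-(x * s))) by rw [mul_pow]; ring,
    Real.mul_rpow (by positivity) (by positivity), Real.mul_rpow (by positivity) (by positivity),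
    ← Real.exp_mul, Real.rpow_mul hx.le, Real.rpow_natCast]
  congr 3; ring

theorem memLp_indicator_block {p' : ℝ≥0∞} {lam : ℝ} (hlam : 0 < lam) {v : ℝ → ℝ}
    (hv : AEStronglyMeasurable v halfLine) {k : ℤ}
    (hV : eLpNorm v p' (volume.restrict (block k)) < ∞) (j : ℕ) :
    MemLp ((block k).indicator fun y => (1 - y ^ lam / scale lam k) ^ j * v y) p' halfLine := by
  rw [memLp_indicator_iff_restrict (measurableSet_block k), halfLine_restrict_block]
  have hv' : AEStronglyMeasurable v (volume.restrict (block k)) :=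
    hv.mono_measure (Measure.restrict_mono (block_subset_Ioi k) le_rfl)
  refine MemLp.of_le ⟨hv', hV⟩ ?_ ?_
  · refine AEStronglyMeasurable.mul (Measurable.aestronglyMeasurable ?_) hv'
    fun_prop
  · refine (ae_restrict_iff' (measurableSet_block k)).2 (.of_forall fun y hy => ?_)
    have h := one_sub_div_scale_mem hlam hy
    have h2 : (0 : ℝ) < 2 ^ (-lam) := by positivity
    rw [norm_mul, norm_pow, Real.norm_of_nonneg h.1]
    exact mul_le_of_le_one_left (norm_nonneg _) (pow_le_one₀ h.1 (by linarith))

/-- The `ℓ^q` norm of the blockwise `L^p` norms is at most the `L^p` norm when `p ≤ q`. -/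
theorem tsum_eLpNorm_block_rpow_le {p q : ℝ≥0∞} (hp : 1 ≤ p) (hpq : p ≤ q) (hq : q ≠ ∞)
    (f : ℝ → ℝ) :
    ∑' k, eLpNorm f p (volume.restrict (block k)) ^ q.toReal ≤
      eLpNorm f p halfLine ^ q.toReal := by
  have hp0 : p ≠ 0 := (one_pos.trans_le hp).ne'
  have hp1 : p ≠ ∞ := (hpq.trans_lt hq.lt_top).ne
  have hp' : 0 < p.toReal := ENNReal.toReal_pos hp0 hp1
  have hpq' : 0 ≤ q.toReal - p.toReal := sub_nonneg.2 (ENNReal.toReal_mono hq hpq)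
  have hpow : ∀ μ : Measure ℝ, eLpNorm f p μ ^ p.toReal = ∫⁻ y, ‖f y‖ₑ ^ p.toReal ∂μ := by
    intro μ
    rw [eLpNorm_eq_lintegral_rpow_enorm_toReal hp0 hp1, ← ENNReal.rpow_mul, one_div,
      inv_mul_cancel₀ hp'.ne', ENNReal.rpow_one]
  have hmono : ∀ k, eLpNorm f p (volume.restrict (block k)) ≤ eLpNorm f p halfLine := fun k =>
    eLpNorm_mono_measure _ (Measure.restrict_mono (block_subset_Ioi k) le_rfl)
  -- The first factor is bounded by the full norm, which needs `p ≤ q`; the second is additive over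
  -- blocks.
  have hsplit : ∀ a : ℝ≥0∞, a ^ q.toReal = a ^ (q.toReal - p.toReal) * a ^ p.toReal := fun a => by
    rw [← ENNReal.rpow_add_of_nonneg _ _ hpq' hp'.le, sub_add_cancel]
  calc _ ≤ ∑' k, eLpNorm f p halfLine ^ (q.toReal - p.toReal) *
        eLpNorm f p (volume.restrict (block k)) ^ p.toReal := by
        refine ENNReal.tsum_le_tsum fun k => ?_
        rw [hsplit]
        exact mul_le_mul_left (ENNReal.rpow_le_rpow (hmono k) hpq') _
    _ = _ := by
      rw [ENNReal.tsum_mul_left, hsplit (eLpNorm f p halfLine)]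
      simp_rw [hpow]
      rw [lintegral_halfLine_eq_tsum]

/-! ### Choice of the polynomial degrees. -/

/-- Distribution of polynomial degrees: a `q`-summable sequence can be reduced to size
`o(n ^ (-1 / q))` by geometric factors with total exponent below `n`. -/
theorem exists_eventually_degrees {q r : ℝ} (hq : 1 ≤ q) (hr0 : 0 < r) (hr1 : r < 1) :
    ∃ C : ℝ, 0 < C ∧ ∀ τ : ℤ → ℝ, (∀ k, 0 ≤ τ k) → Summable (fun k => τ k ^ q) →
      ∀ η : ℝ, 0 < η → ∀ᶠ n : ℕ in atTop, ∃ m : ℤ →₀ ℕ, (m.sum fun _ a => a) < n ∧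
        ∀ k, r ^ m k * τ k ≤ C * (η * (n : ℝ) ^ (-(1 / q))) := by
  have hq0 : 0 < q := by linarith
  obtain ⟨C₀, hC₀⟩ : ∃ C₀ : ℝ, ∀ m : ℕ, ((m + 1 : ℕ) : ℝ) ^ 2 * r ^ (m + 1) ≤ C₀ := by
    obtain ⟨C₀, hC₀⟩ := (tendsto_pow_const_mul_const_pow_of_lt_one 2 hr0.le hr1).bddAbove_range
    exact ⟨C₀, fun m => hC₀ ⟨m + 1, rfl⟩⟩
  have hC₀pos : 0 < C₀ := lt_of_lt_of_le (by positivity) (hC₀ 0)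
  refine ⟨C₀ / r, by positivity, fun τ hτ hsum η hη => ?_⟩
  set ε : ℕ → ℝ := fun n => η * (n : ℝ) ^ (-(1 / q)) with hε
  -- Any exponent strictly between `0` and `q` would do: below `q` the total degree is `o(ε ^
  -- (-q))`; a positive one lets `r ^ d` beat `τ / ε`, which is at most a power of `d + 1`.
  set d : ℕ → ℤ → ℕ := fun n k => ⌊(τ k / ε n) ^ (q / 2)⌋₊ with hd
  have hεpos : ∀ n : ℕ, 0 < n → 0 < ε n := fun n hn => by
    have : (0 : ℝ) < n := by exact_mod_cast hn
    positivity
  have hε0 : Tendsto ε atTop (𝓝 0) := by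
    have := (tendsto_rpow_neg_atTop (by positivity : 0 < 1 / q)).comp
      (tendsto_natCast_atTop_atTop (R := ℝ))
    simpa [hε] using this.const_mul η
  have hεq : ∀ n : ℕ, 0 < n → n * ε n ^ q = η ^ q := fun n hn => by
    have hn' : (0 : ℝ) < n := by exact_mod_cast hn
    simp only [hε]
    rw [Real.mul_rpow hη.le (by positivity), ← Real.rpow_mul hn'.le,
      show -(1 / q) * q = -1 by field_simp, Real.rpow_neg_one]
    field_simp
  have hdle : ∀ n : ℕ, 0 < n → ∀ k, (d n k : ℝ) * ε n ^ q ≤ τ k ^ (q / 2) * ε n ^ (q / 2) := by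
    intro n hn k
    have he := hεpos n hn
    calc (d n k : ℝ) * ε n ^ q ≤ (τ k / ε n) ^ (q / 2) * ε n ^ q := by
          gcongr
          exact Nat.floor_le (Real.rpow_nonneg (div_nonneg (hτ k) he.le) _)
      _ = _ := by
        have h1 : ε n ^ q = ε n ^ (q / 2) * ε n ^ (q / 2) := by
          rw [← Real.rpow_add he]; congr 1; ring
        have h2 : ε n ^ (q / 2) ≠ 0 := (Real.rpow_pos_of_pos he _).ne'
        rw [Real.div_rpow (hτ k) he.le, h1]
        field_simp
  have hone : ∀ n : ℕ, 0 < n → ∀ k, d n k ≠ 0 → ε n ≤ τ k := by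
    intro n hn k hk
    have he := hεpos n hn
    by_contra hlt
    have h0 : 0 ≤ τ k / ε n := div_nonneg (hτ k) he.le
    have h1 : τ k / ε n < 1 := (div_lt_one he).2 (not_le.1 hlt)
    exact hk (Nat.floor_eq_zero.2 (Real.rpow_lt_one h0 h1 (by positivity)))
  have hdom : ∀ n : ℕ, 0 < n → ∀ k, (d n k : ℝ) * ε n ^ q ≤ τ k ^ q := by
    intro n hn k
    rcases eq_or_ne (d n k) 0 with h | h
    · rw [h]; simpa using Real.rpow_nonneg (hτ k) q
    · have he := hεpos n hn
      have ht := hone n hn k h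
      have htpos := he.trans_le ht
      calc _ ≤ τ k ^ (q / 2) * ε n ^ (q / 2) := hdle n hn k
        _ ≤ τ k ^ (q / 2) * τ k ^ (q / 2) := by
          gcongr
        _ = _ := by rw [← Real.rpow_add htpos]; congr 1; ring
  -- Dominated convergence with majorant `τ ^ q`. As `n * ε n ^ q = η ^ q` is fixed, the total
  -- degree is eventually below `n`.
  have hlim : Tendsto (fun n : ℕ => ∑' k, (d n k : ℝ) * ε n ^ q) atTop (𝓝 (∑' _ : ℤ, (0 : ℝ))) := by
    refine tendsto_tsum_of_dominated_convergence hsum (fun k => ?_) ?_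
    · have h1 : Tendsto (fun n => τ k ^ (q / 2) * ε n ^ (q / 2)) atTop (𝓝 0) := by
        have := (hε0.rpow_const (p := q / 2) (Or.inr (by positivity))).const_mul (τ k ^ (q / 2))
        rwa [Real.zero_rpow (by positivity), mul_zero] at this
      refine squeeze_zero' ?_ ?_ h1
      · filter_upwards [eventually_gt_atTop 0] with n hn
        have := hεpos n hn
        positivity
      · filter_upwards [eventually_gt_atTop 0] with n hn using hdle n hn k
    · filter_upwards [eventually_gt_atTop 0] with n hn k
      have := hεpos n hn
      rw [Real.norm_of_nonneg (by positivity)]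
      exact hdom n hn k
  rw [tsum_zero] at hlim
  filter_upwards [hlim.eventually_lt_const (Real.rpow_pos_of_pos hη q), eventually_gt_atTop 0]
    with n hn hn0
  have he := hεpos n hn0
  have hfin : (Function.support (d n)).Finite := by
    have h1 := hsum.tendsto_cofinite_zero.eventually_lt_const (Real.rpow_pos_of_pos he q)
    refine (eventually_cofinite.1 h1).subset fun k hk => ?_
    simpa using Real.rpow_le_rpow he.le (hone n hn0 k hk) hq0.le
  refine ⟨Finsupp.ofSupportFinite (d n) hfin, ?_, fun k => ?_⟩
  · have h2 : ((Finsupp.ofSupportFinite (d n) hfin).sum fun _ a => (a : ℝ) * ε n ^ q) < η ^ q := by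
      refine lt_of_le_of_lt ?_ hn
      refine Summable.sum_le_tsum (f := fun k => (d n k : ℝ) * ε n ^ q) _
        (fun k _ => by positivity) ?_
      exact Summable.of_nonneg_of_le (fun k => by positivity) (hdom n hn0) hsum
    have h3 : (((Finsupp.ofSupportFinite (d n) hfin).sum fun _ a => a : ℕ) : ℝ) * ε n ^ q <
        n * ε n ^ q := by
      rw [hεq n hn0]
      simpa [Finsupp.sum, Finset.sum_mul] using h2
    exact_mod_cast lt_of_mul_lt_mul_right h3 (by positivity)
  · change r ^ d n k * τ k ≤ C₀ / r * ε n
    have h0 : 0 ≤ τ k / ε n := div_nonneg (hτ k) he.le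
    have h1 : (τ k / ε n) ^ (q / 2) ≤ ((d n k + 1 : ℕ) : ℝ) := by
      push_cast; exact (Nat.lt_floor_add_one _).le
    have h2 : τ k / ε n ≤ ((d n k + 1 : ℕ) : ℝ) ^ 2 := by
      calc τ k / ε n = ((τ k / ε n) ^ (q / 2)) ^ (2 / q) := by
            rw [← Real.rpow_mul h0, show q / 2 * (2 / q) = 1 by field_simp, Real.rpow_one]
        _ ≤ ((d n k + 1 : ℕ) : ℝ) ^ (2 / q) := by gcongr
        _ ≤ ((d n k + 1 : ℕ) : ℝ) ^ (2 : ℝ) := by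
          refine Real.rpow_le_rpow_of_exponent_le (by simp) ?_
          rw [div_le_iff₀ hq0]; linarith
        _ = _ := by norm_cast
    rw [div_le_iff₀ he] at h2
    -- The floor only controls `d + 1`; passing from `r ^ d` to `r ^ (d + 1)` produces the division
    -- by `r` in the constant.
    calc r ^ d n k * τ k ≤ r ^ d n k * (((d n k + 1 : ℕ) : ℝ) ^ 2 * ε n) := by gcongr
      _ = ((d n k + 1 : ℕ) : ℝ) ^ 2 * r ^ (d n k + 1) / r * ε n := by
        rw [pow_succ r]; field_simp
      _ ≤ C₀ / r * ε n := by gcongr; exact hC₀ _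

/-! ### Blockwise Taylor approximation of the operator. -/

/-- The `j`-th coefficient function of the Taylor expansion on the `k`-th block. -/
noncomputable def taylorCoeff (lam : ℝ) (k : ℤ) (j : ℕ) (x : ℝ) : ℝ :=
  (x * scale lam k) ^ j / j.factorial * Real.exp (-(x * scale lam k))

/-- The `j`-th moment density of the Taylor expansion on the `k`-th block. -/
noncomputable def taylorMoment (lam : ℝ) (v : ℝ → ℝ) (k : ℤ) (j : ℕ) : ℝ → ℝ :=
  (block k).indicator fun y => (1 - y ^ lam / scale lam k) ^ j * v y

/-- The common ratio in the error of the Taylor expansion. -/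
noncomputable def taylorRatio (lam : ℝ) : ℝ := √(1 - (2 : ℝ) ^ (-lam))

theorem two_rpow_neg_lt_one {lam : ℝ} (hlam : 0 < lam) : (2 : ℝ) ^ (-lam) < 1 :=
  Real.rpow_lt_one_of_one_lt_of_neg one_lt_two (by linarith)

theorem taylorRatio_pos {lam : ℝ} (hlam : 0 < lam) : 0 < taylorRatio lam :=
  Real.sqrt_pos.2 (by linarith [two_rpow_neg_lt_one hlam])

theorem taylorRatio_lt_one (lam : ℝ) : taylorRatio lam < 1 := by
  have : (0 : ℝ) < 2 ^ (-lam) := by positivity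
  rw [taylorRatio, Real.sqrt_lt' one_pos]
  linarith

/-- The blocks are disjoint, so at `y` only the `k`-th inner sum survives and the scalar Taylor
estimate applies. -/
theorem enorm_kernel_sub_taylor_le {lam x : ℝ} (hlam : 0 < lam) (hx : 0 < x) (v f : ℝ → ℝ)
    (m : ℤ →₀ ℕ) {k : ℤ} {y : ℝ} (hy : y ∈ block k) :
    ‖Real.exp (-(x * y ^ lam)) * f y * v y -
        ∑ i ∈ m.support.sigma fun k => Finset.range (m k),
          taylorCoeff lam i.1 i.2 x * (f y * taylorMoment lam v i.1 i.2 y)‖ₑ ≤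
      ENNReal.ofReal (taylorRatio lam ^ m k *
        Real.exp (-((1 - taylorRatio lam) * (x * scale lam k)))) * (‖f y‖ₑ * ‖v y‖ₑ) := by
  have hs := scale_pos lam k
  have h2 : (0 : ℝ) ≤ 1 - 2 ^ (-lam) := by linarith [two_rpow_neg_lt_one hlam]
  have hw := one_sub_div_scale_mem hlam hy
  have hsum : ∑ i ∈ m.support.sigma fun k => Finset.range (m k),
      taylorCoeff lam i.1 i.2 x * (f y * taylorMoment lam v i.1 i.2 y) =
      (∑ j ∈ Finset.range (m k), taylorCoeff lam k j x * (1 - y ^ lam / scale lam k) ^ j) *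
        (f y * v y) := by
    rw [Finset.sum_sigma, Finset.sum_eq_single k]
    · rw [Finset.sum_mul]
      refine Finset.sum_congr rfl fun j _ => ?_
      simp only [taylorMoment, indicator_of_mem hy]
      ring
    · intro k' _ hk'
      refine Finset.sum_eq_zero fun j _ => ?_
      have : y ∉ block k' := fun h => disjoint_left.1 (pairwise_disjoint_block hk') h hy
      simp [taylorMoment, indicator_of_notMem this]
    · intro hk
      simp [Finsupp.notMem_support_iff.1 hk]
  have hT := abs_exp_sub_taylor_le (s := x * scale lam k) (w := y ^ lam / scale lam k)
    (m k) (taylorRatio_pos hlam).le (taylorRatio_lt_one lam).le (by positivity) (by linarith [hw.1])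
    (by rw [taylorRatio, Real.sq_sqrt h2]; exact hw.2)
  rw [show x * scale lam k * (y ^ lam / scale lam k) = x * y ^ lam by field_simp] at hT
  rw [hsum, mul_assoc, ← sub_mul, enorm_mul, enorm_mul]
  gcongr
  rw [Real.enorm_eq_ofReal_abs]
  exact ENNReal.ofReal_le_ofReal hT

/-- Hölder on each block; `hm` then trades the norm of `v` for `δ` and a power of the scale, leaving
a discretized Laplace transform of the block norms of `f`. -/
theorem enorm_integral_kernel_sub_taylor_le {p p' : ℝ≥0∞} [ENNReal.HolderConjugate p p']
    {q lam : ℝ} (hlam : 0 < lam) {v f : ℝ → ℝ}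
    (hv : AEStronglyMeasurable v halfLine) (hf : AEStronglyMeasurable f halfLine) (m : ℤ →₀ ℕ)
    {δ : ℝ≥0∞} (hm : ∀ k, ENNReal.ofReal (taylorRatio lam ^ m k) *
      eLpNorm v p' (volume.restrict (block k)) ≤ δ * ENNReal.ofReal (scale lam k ^ (1 / q)))
    {x : ℝ} (hx : 0 < x) :
    ‖∫ y, (Real.exp (-(x * y ^ lam)) * f y * v y -
        ∑ i ∈ m.support.sigma fun k => Finset.range (m k),
          taylorCoeff lam i.1 i.2 x * (f y * taylorMoment lam v i.1 i.2 y)) ∂halfLine‖ₑ ≤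
      δ * ∑' k, ENNReal.ofReal (scale lam k ^ (1 / q) *
        Real.exp (-((1 - taylorRatio lam) * (x * scale lam k)))) *
          eLpNorm f p (volume.restrict (block k)) := by
  refine (enorm_integral_le_lintegral_enorm _).trans ?_
  rw [lintegral_halfLine_eq_tsum, ← ENNReal.tsum_mul_left]
  refine ENNReal.tsum_le_tsum fun k => ?_
  have hr := (taylorRatio_pos hlam).le
  have hs := scale_pos lam k
  have hle : volume.restrict (block k) ≤ halfLine :=
    Measure.restrict_mono (block_subset_Ioi k) le_rfl
  set e : ℝ := Real.exp (-((1 - taylorRatio lam) * (x * scale lam k))) with he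
  have he0 : 0 ≤ e := (Real.exp_pos _).le
  calc _ ≤ ∫⁻ y in block k, ENNReal.ofReal (taylorRatio lam ^ m k * e) * (‖f y‖ₑ * ‖v y‖ₑ) :=
        setLIntegral_mono' (measurableSet_block k) fun y hy =>
          enorm_kernel_sub_taylor_le hlam hx v f m hy
    _ = ENNReal.ofReal (taylorRatio lam ^ m k * e) * ∫⁻ y in block k, ‖f y‖ₑ * ‖v y‖ₑ :=
        lintegral_const_mul' _ _ ENNReal.ofReal_ne_top
    _ ≤ ENNReal.ofReal (taylorRatio lam ^ m k * e) * (eLpNorm f p (volume.restrict (block k)) *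
          eLpNorm v p' (volume.restrict (block k))) := by
        gcongr
        exact lintegral_enorm_mul_le (hf.mono_measure hle) (hv.mono_measure hle)
    _ = ENNReal.ofReal (taylorRatio lam ^ m k) * eLpNorm v p' (volume.restrict (block k)) *
          (ENNReal.ofReal e * eLpNorm f p (volume.restrict (block k))) := by
        rw [ENNReal.ofReal_mul (by positivity)]; ring
    _ ≤ δ * ENNReal.ofReal (scale lam k ^ (1 / q)) *
          (ENNReal.ofReal e * eLpNorm f p (volume.restrict (block k))) := by
        gcongr ?_ * _
        exact hm k
    _ = _ := by
        rw [ENNReal.ofReal_mul (by positivity)]; ring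

/-- Approximation of the Laplace type transformation by blockwise Taylor polynomials. -/
theorem exists_approxNumber_le_of_degrees {p q : ℝ≥0∞} [Fact (1 ≤ p)] [Fact (1 ≤ q)] {p' : ℝ≥0∞}
    [ENNReal.HolderConjugate p p'] (hpq : p ≤ q) (hq : q ≠ ∞) {lam : ℝ} (hlam : 0 < lam) :
    ∃ B : ℝ≥0, ∀ v : ℝ → ℝ, AEStronglyMeasurable v halfLine →
      (∀ k, eLpNorm v p' (volume.restrict (block k)) < ∞) →
      ∀ T : Lp ℝ p halfLine →L[ℝ] Lp ℝ q halfLine, IsLaplaceTransform lam v T →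
      ∀ (m : ℤ →₀ ℕ) (δ : ℝ≥0∞), (∀ k, ENNReal.ofReal (taylorRatio lam ^ m k) *
        eLpNorm v p' (volume.restrict (block k)) ≤
          δ * ENNReal.ofReal (scale lam k ^ (1 / q.toReal))) →
      ∀ n : ℕ, (m.sum fun _ a => a) < n → approxNumber n T ≤ B * δ := by
  have hp1 : 1 ≤ p := Fact.out
  have hq1 : 1 ≤ q := Fact.out
  have hq0 : q ≠ 0 := (one_pos.trans_le hq1).ne'
  have hqr : 1 ≤ q.toReal := by
    rw [← ENNReal.toReal_one]; exact ENNReal.toReal_mono hq hq1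
  have hqr0 : 0 < q.toReal := by linarith
  obtain ⟨B, hB⟩ := exists_lintegral_tsum_exp_le hqr (sub_pos.2 (taylorRatio_lt_one lam)) hlam
  refine ⟨B ^ (1 / q.toReal), fun v hv hV T hT m δ hm n hn => ?_⟩
  have hg : ∀ i : (_ : ℤ) × ℕ, MemLp (taylorMoment lam v i.1 i.2) p' halfLine := fun i =>
    memLp_indicator_block hlam hv (hV i.1) i.2
  choose l hl using fun i => exists_clm_eq_integral_mul (p := p) (hg i)
  have hψ : ∀ i : (_ : ℤ) × ℕ, MemLp (taylorCoeff lam i.1 i.2) q halfLine := fun i =>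
    memLp_pow_mul_exp_neg hq0 hq i.2 (scale_pos lam i.1)
  -- One rank-one operator for each pair (block, Taylor order), so the rank is at most the total
  -- degree.
  set S := m.support.sigma fun k => Finset.range (m k) with hS
  set K : Lp ℝ p halfLine →L[ℝ] Lp ℝ q halfLine :=
    ∑ i ∈ S, (l i).smulRight ((hψ i).toLp _) with hK
  have hrank : (K : Lp ℝ p halfLine →ₗ[ℝ] Lp ℝ q halfLine).rank < (n : Cardinal) := by
    refine (rank_sum_smulRight_le S l _).trans_lt ?_
    have hcard : S.card = m.sum fun _ a => a := by
      rw [hS, Finset.card_sigma]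
      simp [Finsupp.sum]
    exact_mod_cast hcard ▸ hn
  refine (iInf₂_le K hrank).trans (ContinuousLinearMap.opENorm_le_bound _ fun f => ?_)
  rw [Lp.enorm_def, Lp.enorm_def]
  have hae : ((T - K) f : ℝ → ℝ) =ᵐ[halfLine] fun x =>
      ∫ y, (Real.exp (-(x * y ^ lam)) * f y * v y - ∑ i ∈ S,
        taylorCoeff lam i.1 i.2 x * (f y * taylorMoment lam v i.1 i.2 y)) ∂halfLine := by
    have h1 : (K f : ℝ → ℝ) =ᵐ[halfLine] fun x =>
        ∑ i ∈ S, taylorCoeff lam i.1 i.2 x * l i f := by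
      have h2 : K f = ∑ i ∈ S, l i f • (hψ i).toLp _ := by simp [hK]
      rw [h2]
      refine (Lp.coeFn_finsetSum S _).trans ?_
      have h3 : ∀ᵐ x ∂halfLine, ∀ i ∈ S, (l i f • (hψ i).toLp _ : Lp ℝ q halfLine) x =
          taylorCoeff lam i.1 i.2 x * l i f := by
        refine (ae_ball_iff S.countable_toSet).2 fun i _ => ?_
        filter_upwards [Lp.coeFn_smul (l i f) ((hψ i).toLp _), (hψ i).coeFn_toLp] with x hx1 hx2
        rw [hx1, Pi.smul_apply, hx2, smul_eq_mul, mul_comm]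
      filter_upwards [h3] with x hx
      rw [Finset.sum_apply]
      exact Finset.sum_congr rfl hx
    obtain ⟨hI, hTf⟩ := hT f
    rw [sub_apply]
    filter_upwards [Lp.coeFn_sub (T f) (K f), h1, hI, hTf] with x hx1 hx2 hx3 hx4
    rw [hx1, Pi.sub_apply, hx2, hx4, integral_sub hx3
      (integrable_finsetSum _ fun i _ => ((hl i f).1.const_mul _)),
      integral_finsetSum _ fun i _ => ((hl i f).1.const_mul _)]
    congr 1
    refine Finset.sum_congr rfl fun i _ => ?_
    rw [integral_const_mul, (hl i f).2]
  rw [eLpNorm_congr_ae hae, eLpNorm_eq_lintegral_rpow_enorm_toReal hq0 hq]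
  have hfm := Lp.aestronglyMeasurable f
  calc _ ≤ (∫⁻ x in Ioi (0 : ℝ), (δ * ∑' k, ENNReal.ofReal (scale lam k ^ (1 / q.toReal) *
        Real.exp (-((1 - taylorRatio lam) * (x * scale lam k)))) *
          eLpNorm f p (volume.restrict (block k))) ^ q.toReal) ^ (1 / q.toReal) := by
        refine ENNReal.rpow_le_rpow ?_ (by positivity)
        exact setLIntegral_mono' measurableSet_Ioi fun x hx => ENNReal.rpow_le_rpow
          (enorm_integral_kernel_sub_taylor_le hlam hv hfm m hm hx) hqr0.le
    _ ≤ (δ ^ q.toReal * (B * eLpNorm f p halfLine ^ q.toReal)) ^ (1 / q.toReal) := by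
        refine ENNReal.rpow_le_rpow ?_ (by positivity)
        simp_rw [ENNReal.mul_rpow_of_nonneg _ _ hqr0.le]
        rw [lintegral_const_mul _ (by fun_prop)]
        gcongr
        refine (hB _).trans ?_
        gcongr
        exact tsum_eLpNorm_block_rpow_le hp1 hpq hq f
    _ = _ := by
        rw [ENNReal.mul_rpow_of_nonneg _ _ (by positivity),
          ENNReal.mul_rpow_of_nonneg _ _ (by positivity), ← ENNReal.rpow_mul, ← ENNReal.rpow_mul,
          mul_one_div_cancel hqr0.ne', ENNReal.rpow_one, ENNReal.rpow_one,
          ENNReal.coe_rpow_of_nonneg _ (by positivity)]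
        ring

/-! ### The kernel factor and the rate of the approximation numbers. -/

/-- Two integrals $\int_0^\infty e^{-ax}\,dx=1/a$. Up to a constant the factor is exactly the scale
normalization in the Taylor estimate. -/
theorem kernelFactor_eq {lam q : ℝ} (hlam : 0 < lam) (hq : 0 < q) (k : ℤ) :
    kernelFactor lam q k = ENNReal.ofReal ((1 - (2 : ℝ) ^ (-lam)) ^ (1 / q)) *
      ENNReal.ofReal (scale lam k ^ (-(1 / q))) := by
  have hD : 0 ≤ 1 - (2 : ℝ) ^ (-lam) := by linarith [two_rpow_neg_lt_one hlam]
  have hs := scale_pos lam k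
  have hs' : (2 : ℝ) ^ (((k : ℝ) + 1) * lam) = scale lam k * 2 ^ lam := by
    rw [scale, ← Real.rpow_add two_pos]; congr 1; ring
  have h1 : ∀ a : ℝ, 0 < a → Integrable (fun x : ℝ => Real.exp (-(x * a))) halfLine ∧
      ∫ x, Real.exp (-(x * a)) ∂halfLine = a⁻¹ := by
    intro a ha
    have h2 := integrable_rpow_mul_exp_neg one_pos ha
    have h3 := Real.integral_rpow_mul_exp_neg_mul_Ioi one_pos ha
    simp only [sub_self, Real.rpow_zero, one_mul, Real.rpow_one, Real.Gamma_one, mul_one,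
      one_div, mul_comm a] at h2 h3
    exact ⟨h2, h3⟩
  have hb : 0 < scale lam k * (2 : ℝ) ^ lam := by positivity
  have hab : scale lam k ≤ scale lam k * (2 : ℝ) ^ lam :=
    le_mul_of_one_le_right hs.le (Real.one_le_rpow one_le_two hlam.le)
  have key : ∫⁻ x in Ioi (0 : ℝ), ENNReal.ofReal
      (Real.exp (-(x * (2 : ℝ) ^ ((k : ℝ) * lam))) -
        Real.exp (-(x * (2 : ℝ) ^ (((k : ℝ) + 1) * lam)))) =
      ENNReal.ofReal ((1 - (2 : ℝ) ^ (-lam)) * (scale lam k)⁻¹) := by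
    rw [hs']
    change ∫⁻ x in Ioi (0 : ℝ), ENNReal.ofReal (Real.exp (-(x * scale lam k)) - _) = _
    have hsub : Integrable (fun x : ℝ => Real.exp (-(x * scale lam k)) -
        Real.exp (-(x * (scale lam k * (2 : ℝ) ^ lam)))) halfLine := (h1 _ hs).1.sub (h1 _ hb).1
    rw [← ofReal_integral_eq_lintegral_ofReal hsub,
      integral_sub (h1 _ hs).1 (h1 _ hb).1, (h1 _ hs).2, (h1 _ hb).2]
    · congr 1
      rw [Real.rpow_neg two_pos.le, mul_inv]; ring
    · refine (ae_restrict_iff' measurableSet_Ioi).2 (.of_forall fun x hx => ?_)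
      have hx : 0 < x := hx
      simp only [Pi.zero_apply, sub_nonneg, Real.exp_le_exp, neg_le_neg_iff]
      gcongr
  rw [kernelFactor, key, ENNReal.ofReal_rpow_of_nonneg (by positivity) (by positivity),
    Real.mul_rpow hD (by positivity), ENNReal.ofReal_mul (by positivity),
    Real.inv_rpow hs.le, Real.rpow_neg hs.le]

theorem kernelFactor_ne_zero {lam q : ℝ} (hlam : 0 < lam) (hq : 0 < q) (k : ℤ) :
    kernelFactor lam q k ≠ 0 := by
  have hD : 0 < 1 - (2 : ℝ) ^ (-lam) := by linarith [two_rpow_neg_lt_one hlam]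
  have hs := scale_pos lam k
  rw [kernelFactor_eq hlam hq]
  exact mul_ne_zero (ENNReal.ofReal_pos.2 (by positivity)).ne'
    (ENNReal.ofReal_pos.2 (by positivity)).ne'

/-- The approximation numbers are `o(n ^ (-1 / q))` when the block norms are `q`-summable. -/
theorem tendsto_rpow_mul_approxNumber {p q : ℝ≥0∞} [Fact (1 ≤ p)] [Fact (1 ≤ q)] (p' : ℝ≥0∞)
    [ENNReal.HolderConjugate p p'] (hpq : p ≤ q) (hq : q ≠ ∞) {lam : ℝ} (hlam : 0 < lam)
    {v : ℝ → ℝ} (hv : AEStronglyMeasurable v halfLine)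
    {T : Lp ℝ p halfLine →L[ℝ] Lp ℝ q halfLine} (hT : IsLaplaceTransform lam v T)
    (hsum : ∑' k, (kernelFactor lam q.toReal k *
      eLpNorm v p' (volume.restrict (block k))) ^ q.toReal < ∞) :
    Tendsto (fun n : ℕ => (n : ℝ≥0∞) ^ (1 / q.toReal) * approxNumber n T) atTop (𝓝 0) := by
  have hq1 : 1 ≤ q := Fact.out
  have hqr : 1 ≤ q.toReal := by
    rw [← ENNReal.toReal_one]; exact ENNReal.toReal_mono hq hq1
  have hqr0 : 0 < q.toReal := by linarith
  set V : ℤ → ℝ≥0∞ := fun k => eLpNorm v p' (volume.restrict (block k)) with hVdef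
  set D : ℝ := (1 - (2 : ℝ) ^ (-lam)) ^ (1 / q.toReal) with hDdef
  have hD : 0 < D := Real.rpow_pos_of_pos (by linarith [two_rpow_neg_lt_one hlam]) _
  have hterm : ∀ k, kernelFactor lam q.toReal k * V k < ∞ := fun k => by
    have h := ENNReal.ne_top_of_tsum_ne_top hsum.ne k
    exact ((ENNReal.rpow_lt_top_iff_of_pos hqr0).1 h.lt_top)
  have hV : ∀ k, V k < ∞ := fun k =>
    ENNReal.lt_top_of_mul_ne_top_right (hterm k).ne (kernelFactor_ne_zero hlam hqr0 k)
  set τ : ℤ → ℝ := fun k => (kernelFactor lam q.toReal k * V k).toReal with hτ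
  have hτsum : Summable fun k => τ k ^ q.toReal := by
    have h := ENNReal.summable_toReal hsum.ne
    simpa only [hτ, ENNReal.toReal_rpow] using h
  obtain ⟨C, hC, hdeg⟩ := exists_eventually_degrees hqr (taylorRatio_pos hlam)
    (taylorRatio_lt_one lam)
  obtain ⟨B, hB⟩ := exists_approxNumber_le_of_degrees (p := p) (q := q) (p' := p') hpq hq hlam
  have hmain : ∀ η : ℝ, 0 < η → ∀ᶠ n : ℕ in atTop,
      (n : ℝ≥0∞) ^ (1 / q.toReal) * approxNumber n T ≤ ENNReal.ofReal (B * (C / D) * η) := by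
    intro η hη
    filter_upwards [hdeg τ (fun k => ENNReal.toReal_nonneg) hτsum η hη, eventually_gt_atTop 0]
      with n ⟨m, hmn, hm⟩ hn
    have hn' : (0 : ℝ) < n := by exact_mod_cast hn
    have h1 := hB v hv hV T hT m
      (ENNReal.ofReal (C / D * (η * (n : ℝ) ^ (-(1 / q.toReal))))) (fun k => ?_) n hmn
    · calc _ ≤ (n : ℝ≥0∞) ^ (1 / q.toReal) *
            (B * ENNReal.ofReal (C / D * (η * (n : ℝ) ^ (-(1 / q.toReal))))) := by gcongr
        _ = _ := by
          rw [← ENNReal.ofReal_natCast n, ENNReal.ofReal_rpow_of_pos hn',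
            ← ENNReal.ofReal_coe_nnreal, ← ENNReal.ofReal_mul (by positivity),
            ← ENNReal.ofReal_mul (by positivity), Real.rpow_neg hn'.le]
          congr 1
          have : (n : ℝ) ^ (1 / q.toReal) ≠ 0 := (Real.rpow_pos_of_pos hn' _).ne'
          field_simp
    · have hs := scale_pos lam k
      have hτV : τ k = D * (scale lam k ^ (-(1 / q.toReal))) * (V k).toReal := by
        simp only [hτ]
        rw [kernelFactor_eq hlam hqr0, ENNReal.toReal_mul, ENNReal.toReal_mul,
          ENNReal.toReal_ofReal hD.le, ENNReal.toReal_ofReal (by positivity)]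
      have h2 := hm k
      change _ * V k ≤ _
      rw [← ENNReal.ofReal_toReal (hV k).ne,
        ← ENNReal.ofReal_mul (pow_nonneg (taylorRatio_pos hlam).le _),
        ← ENNReal.ofReal_mul (by positivity)]
      refine ENNReal.ofReal_le_ofReal ?_
      have hsp : 0 < scale lam k ^ (1 / q.toReal) := Real.rpow_pos_of_pos hs _
      rw [hτV, Real.rpow_neg hs.le] at h2
      calc taylorRatio lam ^ m k * (V k).toReal =
            taylorRatio lam ^ m k * (D * (scale lam k ^ (1 / q.toReal))⁻¹ * (V k).toReal) *
              (scale lam k ^ (1 / q.toReal) / D) := by field_simp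
        _ ≤ C * (η * (n : ℝ) ^ (-(1 / q.toReal))) * (scale lam k ^ (1 / q.toReal) / D) := by gcongr
        _ = _ := by field_simp
  refine ENNReal.tendsto_nhds_zero.2 fun ε hε => ?_
  rcases eq_or_ne ε ∞ with rfl | hε'
  · exact .of_forall fun _ => le_top
  · have hε0 : 0 < ε.toReal := ENNReal.toReal_pos hε.ne' hε'
    have hA : 0 ≤ B * (C / D) := by positivity
    -- The `+ 1` keeps the denominator positive even if `B = 0`.
    filter_upwards [hmain (ε.toReal / (B * (C / D) + 1)) (by positivity)] with n hn
    refine hn.trans (ENNReal.ofReal_le_of_le_toReal ?_)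
    rw [mul_div_assoc', div_le_iff₀ (by positivity)]
    nlinarith

/-! ### Summability of the block norms and conclusion. -/

/-- The inclusion of `ℓ^θ` in `ℓ^q`: each term is at most the whole `ℓ^θ` quantity `M`, which
absorbs the excess power `q - θ`. -/
theorem tsum_rpow_lt_top_of_le {σ : ℤ → ℝ≥0∞} {θ q : ℝ} (hθ : 0 < θ) (hθq : θ ≤ q)
    (h : ∑' k, σ k ^ θ < ∞) : ∑' k, σ k ^ q < ∞ := by
  set M := (∑' k, σ k ^ θ) ^ (1 / θ) with hM
  have hM' : M < ∞ := ENNReal.rpow_lt_top_of_nonneg (by positivity) h.ne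
  have hle : ∀ k, σ k ≤ M := fun k => by
    rw [hM, one_div, ENNReal.le_rpow_inv_iff hθ]
    exact ENNReal.le_tsum k
  calc ∑' k, σ k ^ q ≤ ∑' k, M ^ (q - θ) * σ k ^ θ := by
        refine ENNReal.tsum_le_tsum fun k => ?_
        rw [show σ k ^ q = σ k ^ (q - θ) * σ k ^ θ by
          rw [← ENNReal.rpow_add_of_nonneg _ _ (by linarith) hθ.le, sub_add_cancel]]
        exact mul_le_mul_left (ENNReal.rpow_le_rpow (hle k) (by linarith)) _
    _ = M ^ (q - θ) * ∑' k, σ k ^ θ := ENNReal.tsum_mul_left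
    _ < ∞ := ENNReal.mul_lt_top (ENNReal.rpow_lt_top_of_nonneg (by linarith) hM'.ne) h

theorem enorm_eq_ofReal_on_dyadic {v : ℝ → ℝ} (hv : ∀ y, 0 ≤ y → 0 ≤ v y) (k : ℤ) {y : ℝ}
    (hy : y ∈ dyadic k) : ‖v y‖ₑ = ENNReal.ofReal (v y) :=
  Real.enorm_of_nonneg (hv y ((zpow_pos two_pos _).le.trans hy.1))

theorem kernelFactor_mul_eLpNorm_le_sigma {lam q p' : ℝ} (hp' : 0 < p') {v : ℝ → ℝ}
    (hv : ∀ y, 0 ≤ y → 0 ≤ v y) (k : ℤ) :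
    kernelFactor lam q k * eLpNorm v (ENNReal.ofReal p') (volume.restrict (block k)) ≤
      sigma lam p' q v k := by
  rw [sigma, eLpNorm_eq_lintegral_rpow_enorm_toReal (ENNReal.ofReal_pos.2 hp').ne'
    ENNReal.ofReal_ne_top, ENNReal.toReal_ofReal hp'.le]
  refine mul_le_mul_right (ENNReal.rpow_le_rpow ?_ (by positivity)) _
  refine (lintegral_mono_set (block_subset_dyadic k)).trans_eq ?_
  exact setLIntegral_congr_fun measurableSet_Icc fun y hy => by
    simp only [enorm_eq_ofReal_on_dyadic hv k hy]

theorem kernelFactor_mul_eLpNorm_le_sigmaBar {lam q : ℝ} {v : ℝ → ℝ}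
    (hv : ∀ y, 0 ≤ y → 0 ≤ v y) (k : ℤ) :
    kernelFactor lam q k * eLpNorm v ∞ (volume.restrict (block k)) ≤ sigmaBar lam q v k := by
  rw [sigmaBar, mul_comm, eLpNorm_exponent_top, eLpNormEssSup]
  gcongr
  calc _ ≤ essSup (fun y => ‖v y‖ₑ) (volume.restrict (dyadic k)) :=
        essSup_mono_measure (Measure.absolutelyContinuous_of_le
          (Measure.restrict_mono (block_subset_dyadic k) le_rfl))
    _ = _ := essSup_congr_ae ((ae_restrict_iff' measurableSet_Icc).2
        (.of_forall fun y hy => enorm_eq_ofReal_on_dyadic hv k hy))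

theorem aestronglyMeasurable_halfLine {v : ℝ → ℝ} (hv : LocallyIntegrableOn v (Ici 0) volume) :
    AEStronglyMeasurable v halfLine :=
  hv.aestronglyMeasurable.mono_measure (Measure.restrict_mono Ioi_subset_Ici_self le_rfl)

end LaplaceApprox

theorem theorem4p1 (p q : ℝ≥0∞) [Fact (1 ≤ p)] [Fact (1 ≤ q)] (hpq : p ≤ q) (hq : q ≠ ∞)
    (lam : ℝ) (hlam : 0 < lam) :
    (1 < p → ∀ p' θ : ℝ, p' = p.toReal / (p.toReal - 1) →
      θ = p' * q.toReal / (p' + q.toReal) →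
      ∃ C : ℝ≥0, ∀ v : ℝ → ℝ, (∀ y, 0 ≤ y → 0 ≤ v y) →
        LocallyIntegrableOn v (Ici 0) volume →
        ∀ T : Lp ℝ p LaplaceApprox.halfLine →L[ℝ] Lp ℝ q LaplaceApprox.halfLine,
          LaplaceApprox.IsLaplaceTransform lam v T → IsCompactOperator T →
          ∑' k : ℤ, LaplaceApprox.sigma lam p' q.toReal v k ^ θ < ∞ →
          limsup (fun n : ℕ => (n : ℝ≥0∞) ^ (1 / q.toReal) * LaplaceApprox.approxNumber n T) atTop
            ≤ C * (∫⁻ t in Ioi (0 : ℝ), ENNReal.ofReal (t ^ (-((lam + 1) * θ / q.toReal))) *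
                ENNReal.ofReal (v t) ^ θ) ^ (1 / θ)) ∧
    (p = 1 →
      ∃ C : ℝ≥0, ∀ v : ℝ → ℝ, (∀ y, 0 ≤ y → 0 ≤ v y) →
        LocallyIntegrableOn v (Ici 0) volume →
        ∀ T : Lp ℝ p LaplaceApprox.halfLine →L[ℝ] Lp ℝ q LaplaceApprox.halfLine,
          LaplaceApprox.IsLaplaceTransform lam v T → IsCompactOperator T →
          ∑' k : ℤ, LaplaceApprox.sigmaBar lam q.toReal v k ^ q.toReal < ∞ →
          limsup (fun n : ℕ => (n : ℝ≥0∞) ^ (1 / q.toReal) * LaplaceApprox.approxNumber n T) atTop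
            ≤ C * (∫⁻ t in Ioi (0 : ℝ), ENNReal.ofReal (t ^ (-lam - 1)) *
                LaplaceApprox.localEssSup v t ^ q.toReal) ^ (1 / q.toReal)) := by
  have hq1 : 1 ≤ q := Fact.out
  have hqr : 1 ≤ q.toReal := by
    rw [← ENNReal.toReal_one]; exact ENNReal.toReal_mono hq hq1
  have hqr0 : 0 < q.toReal := by linarith
  -- The constant `1` is arbitrary, since the left-hand sides turn out to be `0`.
  refine ⟨fun hp p' θ hp' hθ => ⟨1, fun v hv hvi T hT _ hsum => ?_⟩,
    fun hp => ⟨1, fun v hv hvi T hT _ hsum => ?_⟩⟩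
  · have hpt : p ≠ ∞ := (hpq.trans_lt hq.lt_top).ne
    have hpr : 1 < p.toReal := by
      rw [← ENNReal.toReal_one]
      exact (ENNReal.toReal_lt_toReal ENNReal.one_ne_top hpt).2 hp
    have hconj : p.toReal.HolderConjugate p' :=
      (Real.holderConjugate_iff_eq_conjExponent hpr).2 hp'
    have hp'0 : 0 < p' := hconj.symm.pos
    have : ENNReal.HolderConjugate p (ENNReal.ofReal p') := by
      have h := hconj.ennrealOfReal
      rwa [ENNReal.ofReal_toReal hpt] at h
    have hθ0 : 0 < θ := by rw [hθ]; positivity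
    have hθq : θ ≤ q.toReal := by
      rw [hθ, div_le_iff₀ (by positivity)]
      nlinarith
    have hlim := LaplaceApprox.tendsto_rpow_mul_approxNumber (ENNReal.ofReal p') hpq hq hlam
      (LaplaceApprox.aestronglyMeasurable_halfLine hvi) hT <|
      lt_of_le_of_lt (ENNReal.tsum_le_tsum fun k => ENNReal.rpow_le_rpow
        (LaplaceApprox.kernelFactor_mul_eLpNorm_le_sigma hp'0 hv k) hqr0.le)
        (LaplaceApprox.tsum_rpow_lt_top_of_le hθ0 hθq hsum)
    rw [hlim.limsup_eq]
    exact zero_le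
  · subst hp
    have : ENNReal.HolderConjugate 1 ∞ := .one_top
    have hlim := LaplaceApprox.tendsto_rpow_mul_approxNumber ∞ hpq hq hlam
      (LaplaceApprox.aestronglyMeasurable_halfLine hvi) hT <|
      lt_of_le_of_lt (ENNReal.tsum_le_tsum fun k => ENNReal.rpow_le_rpow
        (LaplaceApprox.kernelFactor_mul_eLpNorm_le_sigmaBar hv k) hqr0.le) hsum
    rw [hlim.limsup_eq]
    exact zero_le
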